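/- Let $\rho_i$ ($i\in I$, $I$ finite) be density matrices (positive semidefinite complex matrices of trace one) on a finite-dimensional Hilbert space, let $(p_i)_{i\in I}$ be a probability distribution, and put $\rho=\sum_i p_i\rho_i$. Let $(M_j)_{j\in J}$ be a POVM with finitely many outcomes ($M_j\ge 0$, $\sum_j M_j=\mathbb{1}$), and define the joint distribution $P_{ij}=p_i\,\mathrm{Tr}[\sqrt{M_j}\,\rho_i\sqrt{M_j}]$ and the outcome distribution $q_j=\mathrm{Tr}[M_j\rho]$, with $(p\times q)_{ij}=p_iq_j$. For finite distributions $r,s$ let $B(r\|s)=\sum_x\sqrt{r_xs_x}$, and for density matrices let $B(\sigma\|\tau)=\mathrm{Tr}\sqrt{\sqrt{\tau}\,\sigma\sqrt{\tau}}$, $F(\sigma\|\tau)=B(\sigma\|\tau)^2$ and $d_B^2(\sigma\|\tau)=2[1-B(\sigma\|\tau)]$ (the squared Bures distance). Then, for every such measurement: 1. $d_B^2\Big(\sum_{i,j}P_{ij}\,|i\rangle\langle i|\otimes|j\rangle\langle j|\ \Big\|\ \sum_{i,j}p_iq_j\,|i\rangle\langle i|\otimes|j\rangle\langle j|\Big)\le\sum_i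 p_i\,d_B^2(\rho_i\|\rho)$, where $(|i\rangle)_{i\in I}$ and $(|j\rangle)_{j\in J}$ are the standard orthonormal bases of $\mathbb{C}^I$ and $\mathbb{C}^J$; 2. $B(P\|p\times q)\ge\sum_i p_i\,B(\rho_i\|\rho)$; 3. $F(\sigma\|\tau)\ge\mathrm{Tr}(\sigma\tau)$ for all density matrices $\sigma,\tau$ on this Hilbert space; 4. $B(P\|p\times q)\ge\mathrm{Tr}(\rho^2)$, the purity of the average state. -/

import Mathlib

open scoped MatrixOrder ComplexOrder Kronecker

noncomputable section

namespace BhattacharyyaHolevo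

variable {d ι κ : Type*} [Fintype d] [DecidableEq d]

/-- A density matrix: positive semidefinite with unit trace. -/
structure IsDensityMatrix (ρ : Matrix d d ℂ) : Prop where
  posSemidef : ρ.PosSemidef
  trace_eq_one : ρ.trace = 1

/-- A positive-operator valued measure with finitely many outcomes `κ`. -/
structure IsPOVM [Fintype κ] (M : κ → Matrix d d ℂ) : Prop where
  posSemidef : ∀ j, (M j).PosSemidef
  sum_eq_one : ∑ j, M j = 1

/-- The average state `ρ = ∑ i, p i ρ i` of an ensemble. -/
def averageState [Fintype ι] (p : ι → ℝ) (ρ : ι → Matrix d d ℂ) : Matrix d d ℂ :=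
  ∑ i, (p i : ℂ) • ρ i

/-- The probability `q j = Tr (M j ρ)` of outcome `j` on the average state. -/
def outcomeProb [Fintype ι] (p : ι → ℝ) (ρ : ι → Matrix d d ℂ)
    (M : κ → Matrix d d ℂ) (j : κ) : ℝ :=
  (M j * averageState p ρ).trace.re

/-- The conditional probability `Tr (√(M j) ρ i √(M j))` of outcome `j` given preparation `i`. -/
def condProb (ρ : ι → Matrix d d ℂ) (M : κ → Matrix d d ℂ) (i : ι) (j : κ) : ℝ :=
  (CFC.sqrt (M j) * ρ i * CFC.sqrt (M j)).trace.re

/-- The joint distribution `P` of preparation and outcome. -/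
def jointProb (p : ι → ℝ) (ρ : ι → Matrix d d ℂ) (M : κ → Matrix d d ℂ) (x : ι × κ) : ℝ :=
  p x.1 * condProb ρ M x.1 x.2

/-- The product `p × q` of the two marginal distributions. -/
def productProb [Fintype ι] (p : ι → ℝ) (ρ : ι → Matrix d d ℂ)
    (M : κ → Matrix d d ℂ) (x : ι × κ) : ℝ :=
  p x.1 * outcomeProb p ρ M x.2

/-- The Bhattacharyya coefficient `∑ √(r x * s x)` of two finite distributions. -/
def classicalBhattacharyya {α : Type*} [Fintype α] (r s : α → ℝ) : ℝ :=
  ∑ x, √(r x * s x)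

/-- The quantum Bhattacharyya coefficient `Tr √(√σ ρ √σ)`. -/
def bhattacharyya (ρ σ : Matrix d d ℂ) : ℝ :=
  (CFC.sqrt (CFC.sqrt σ * ρ * CFC.sqrt σ)).trace.re

/-- The quantum fidelity, the square of the Bhattacharyya coefficient. -/
def fidelity (ρ σ : Matrix d d ℂ) : ℝ :=
  bhattacharyya ρ σ ^ 2

/-- The squared Bures distance `2 (1 - B(ρ‖σ))`. -/
def sqBures (ρ σ : Matrix d d ℂ) : ℝ :=
  2 * (1 - bhattacharyya ρ σ)

/-- The purity `Tr (ρ ^ 2)`. -/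
def purity (ρ : Matrix d d ℂ) : ℝ :=
  (ρ ^ 2).trace.re

/-- The classical state `∑ i j, r (i, j) |i⟩⟨i| ⊗ |j⟩⟨j|` that encodes a distribution `r`
on pairs. -/
def ccState [Fintype ι] [DecidableEq ι] [Fintype κ] [DecidableEq κ] (r : ι × κ → ℝ) :
    Matrix (ι × κ) (ι × κ) ℂ :=
  ∑ i, ∑ j, (r (i, j) : ℂ) • (Matrix.single i i (1 : ℂ) ⊗ₖ Matrix.single j j (1 : ℂ))

end BhattacharyyaHolevo

end

/-!
The heart of the matter is that measuring cannot decrease the Bhattacharyya coefficient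
(`bhattacharyya_le_sum_sqrt`): for positive semidefinite `σ, τ` and every POVM `M`,
`B(σ‖τ) ≤ ∑ j, √(Tr (M j σ) * Tr (M j τ))`. Since `B(σ‖τ) = Tr |√σ √τ|`, a polar decomposition gives
a contraction `W` with `B(σ‖τ) = Tr (W √σ √τ)`. Inserting `∑ j, M j = 1` between the roots splits
this into the Hilbert–Schmidt inner products of `√(M j) √σ Wᴴ` and `√(M j) √τ`, which
Cauchy–Schwarz bounds by the terms of the right-hand side.

Taking `σ = ρ i` and `τ` the average state, and averaging over `i` with weights `p i`, gives the
Holevo inequality for the coefficient (`sum_mul_bhattacharyya_le`). The one for the Bures distance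
is the same statement, because the coefficient of two diagonal matrices is the classical one.

With `S = √(√τ σ √τ)`, the fidelity bound is `Tr S² ≤ (Tr S)²`, which holds for `S ≥ 0`. As
`B ≤ 1` (the trivial measurement), `B(ρ i‖ρ) ≥ F(ρ i‖ρ) ≥ Tr (ρ i ρ)`, and averaging over `i` gives
the purity bound.
-/

namespace BhattacharyyaHolevo

open Matrix

variable {d ι κ : Type*} [Fintype d]

/-! ### Traces and positive semidefinite matrices -/

theorem re_trace_conjTranspose_mul_self (A : Matrix d d ℂ) :
    (Aᴴ * A).trace.re = ∑ x : d × d, ‖A x.1 x.2‖ ^ 2 := by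
  simp only [trace, diag_apply, mul_apply, conjTranspose_apply, Complex.re_sum,
    Fintype.sum_prod_type]
  rw [Finset.sum_comm]
  refine Finset.sum_congr rfl fun i _ ↦ Finset.sum_congr rfl fun j _ ↦ ?_
  rw [Complex.star_def, ← Complex.normSq_eq_conj_mul_self, Complex.ofReal_re, Complex.sq_norm]

/-- The Cauchy–Schwarz inequality for the Hilbert–Schmidt inner product. -/
theorem re_trace_conjTranspose_mul_le (A B : Matrix d d ℂ) :
    (Aᴴ * B).trace.re ≤ √((Aᴴ * A).trace.re * (Bᴴ * B).trace.re) := by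
  have h : (Aᴴ * B).trace.re ≤ ∑ x : d × d, ‖A x.1 x.2‖ * ‖B x.1 x.2‖ := by
    simp only [trace, diag_apply, mul_apply, conjTranspose_apply, Complex.re_sum,
      Fintype.sum_prod_type]
    rw [Finset.sum_comm]
    refine Finset.sum_le_sum fun i _ ↦ Finset.sum_le_sum fun j _ ↦ ?_
    refine (Complex.re_le_norm _).trans ?_
    rw [norm_mul, norm_star]
  refine h.trans ((Real.sum_mul_le_sqrt_mul_sqrt _ _ _).trans ?_)
  rw [re_trace_conjTranspose_mul_self, re_trace_conjTranspose_mul_self,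
    Real.sqrt_mul (Finset.sum_nonneg fun _ _ ↦ sq_nonneg _)]

theorem re_trace_nonneg {A : Matrix d d ℂ} (hA : A.PosSemidef) : 0 ≤ A.trace.re :=
  (Complex.nonneg_iff.mp hA.trace_nonneg).1

theorem isDensityMatrix_averageState [Fintype ι] {p : ι → ℝ} {ρ : ι → Matrix d d ℂ}
    (hp : p ∈ stdSimplex ℝ ι) (hρ : ∀ i, IsDensityMatrix (ρ i)) :
    IsDensityMatrix (averageState p ρ) where
  posSemidef := posSemidef_sum _ fun i _ ↦
    (hρ i).posSemidef.smul (Complex.zero_le_real.mpr (hp.1 i))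
  trace_eq_one := by
    simp only [averageState, trace_sum, trace_smul, (hρ _).trace_eq_one, smul_eq_mul, mul_one]
    rw [← Complex.ofReal_sum, hp.2, Complex.ofReal_one]

variable [DecidableEq d]

theorem isHermitian_sqrt (A : Matrix d d ℂ) : (CFC.sqrt A)ᴴ = CFC.sqrt A :=
  (nonneg_iff_posSemidef.mp (CFC.sqrt_nonneg A)).isHermitian

theorem sqrt_mul_sqrt {A : Matrix d d ℂ} (hA : A.PosSemidef) : CFC.sqrt A * CFC.sqrt A = A :=
  CFC.sqrt_mul_sqrt_self A hA.nonneg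

/-- For `A ≥ 0`, the trace of `A²` is at most the square of the trace: compare the sum of the
squared eigenvalues with the square of their sum. -/
theorem re_trace_mul_self_le_sq {A : Matrix d d ℂ} (hA : A.PosSemidef) :
    (A * A).trace.re ≤ A.trace.re ^ 2 := by
  have h1 : A.trace.re = ∑ i, hA.isHermitian.eigenvalues i := by
    rw [hA.isHermitian.trace_eq_sum_eigenvalues]; simp
  have h2 : (A * A).trace.re = ∑ i, hA.isHermitian.eigenvalues i ^ 2 := by
    conv_lhs => rw [hA.isHermitian.spectral_theorem, ← map_mul]
    rw [Unitary.conjStarAlgAut_apply, trace_mul_cycle]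
    simp [diagonal_mul_diagonal, trace_diagonal, sq]
  rw [h1, h2]
  exact Finset.sum_sq_le_sq_sum_of_nonneg fun i _ ↦ hA.eigenvalues_nonneg i

/-! ### Polar decomposition -/

/-- A Hermitian matrix has a Hermitian Moore–Penrose inverse, obtained by applying `x ↦ x⁻¹` with
the convention `0⁻¹ = 0` in the functional calculus. -/
theorem exists_isHermitian_pseudoinverse {S : Matrix d d ℂ} (hS : S.IsHermitian) :
    ∃ T : Matrix d d ℂ, T.IsHermitian ∧ T * S * S = S ∧ T * S * T = T := by
  have hc (f : ℝ → ℝ) : ContinuousOn f (spectrum ℝ S) := S.finite_real_spectrum.continuousOn f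
  have hS' : IsSelfAdjoint S := hS
  have hid : S = cfc (fun x : ℝ ↦ x) S := (cfc_id' ℝ S).symm
  refine ⟨cfc (fun x : ℝ ↦ x⁻¹) S, cfc_predicate (p := IsSelfAdjoint) _ S, ?_, ?_⟩
  · calc cfc (fun x : ℝ ↦ x⁻¹) S * S * S
        = cfc (fun x : ℝ ↦ x⁻¹) S * cfc (fun x : ℝ ↦ x) S * cfc (fun x : ℝ ↦ x) S := by
          rw [← hid]
      _ = cfc (fun x : ℝ ↦ x⁻¹ * x * x) S := by
          rw [← cfc_mul _ _ S (hc _) (hc _), ← cfc_mul _ _ S (hc _) (hc _)]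
      _ = S := by simp_rw [inv_mul_mul_self]; exact hid.symm
  · calc cfc (fun x : ℝ ↦ x⁻¹) S * S * cfc (fun x : ℝ ↦ x⁻¹) S
        = cfc (fun x : ℝ ↦ x⁻¹) S * cfc (fun x : ℝ ↦ x) S * cfc (fun x : ℝ ↦ x⁻¹) S := by
          rw [← hid]
      _ = cfc (fun x : ℝ ↦ x⁻¹ * x * x⁻¹) S := by
          rw [← cfc_mul _ _ S (hc _) (hc _), ← cfc_mul _ _ S (hc _) (hc _)]
      _ = cfc (fun x : ℝ ↦ x⁻¹) S := by
          congr 1; funext x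
          rcases eq_or_ne x 0 with rfl | hx
          · simp
          · field_simp

/-- One half of the polar decomposition: `|A| = W A` for a contraction `W`, here a partial
isometry. Contractivity is recorded as `Wᴴ W` being an orthogonal projection. -/
theorem exists_partialIsometry_mul_eq_sqrt (A : Matrix d d ℂ) :
    ∃ W : Matrix d d ℂ, W * A = CFC.sqrt (Aᴴ * A) ∧ IsIdempotentElem (Wᴴ * W) := by
  set S := CFC.sqrt (Aᴴ * A) with hSdef
  have hSS : S * S = Aᴴ * A := sqrt_mul_sqrt (posSemidef_conjTranspose_mul_self A)
  obtain ⟨T, hT, h1, h2⟩ := exists_isHermitian_pseudoinverse (isHermitian_sqrt (Aᴴ * A))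
  rw [← hSdef] at h1 h2
  -- `T` inverts `S = |A|` on its range, so the adjoint `A T` of the witness is the usual polar
  -- factor `A |A|⁻¹`, extended by zero to the kernel.
  refine ⟨T * Aᴴ, ?_, ?_⟩
  · rw [mul_assoc, ← hSS, ← mul_assoc, h1]
  · have h3 : T * (T * (Aᴴ * (A * (T * T)))) = T * T := by
      calc T * (T * (Aᴴ * (A * (T * T)))) = T * (T * (Aᴴ * A) * (T * T)) := by
            simp only [mul_assoc]
        _ = T * (T * S * S * (T * T)) := by rw [← hSS, ← mul_assoc T S S]
        _ = T * (S * (T * T)) := by rw [h1]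
        _ = T * S * T * T := by simp only [mul_assoc]
        _ = T * T := by rw [h2]
    rw [IsIdempotentElem, conjTranspose_mul, conjTranspose_conjTranspose, hT.eq]
    calc A * T * (T * Aᴴ) * (A * T * (T * Aᴴ))
        = A * (T * (T * (Aᴴ * (A * (T * T))))) * Aᴴ := by simp only [mul_assoc]
      _ = A * T * (T * Aᴴ) := by rw [h3]; simp only [mul_assoc]

/-- Conjugation by a contraction does not increase the trace of a positive semidefinite matrix. -/
theorem re_trace_conj_le {W N : Matrix d d ℂ} (hW : IsIdempotentElem (Wᴴ * W))
    (hN : N.PosSemidef) : (W * N * Wᴴ).trace.re ≤ N.trace.re := by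
  have hQ : (1 - Wᴴ * W)ᴴ = 1 - Wᴴ * W := by simp
  have h := re_trace_nonneg (hN.mul_mul_conjTranspose_same (1 - Wᴴ * W))
  rw [hQ, trace_mul_cycle, hW.one_sub.eq, sub_mul, one_mul, trace_sub, Complex.sub_re] at h
  rw [mul_assoc, trace_mul_comm, mul_assoc, trace_mul_comm]
  linarith

/-! ### The quantum Bhattacharyya coefficient -/

/-- The Bhattacharyya coefficient does not decrease under measurement: by polar decomposition it
is `Tr (W √σ √τ) = ∑ j, Tr (W √σ M j √τ)`, and each term is bounded by Cauchy–Schwarz. -/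
theorem bhattacharyya_le_sum_sqrt [Fintype κ] {M : κ → Matrix d d ℂ} (hM : IsPOVM M)
    {σ τ : Matrix d d ℂ} (hσ : σ.PosSemidef) (hτ : τ.PosSemidef) :
    bhattacharyya σ τ ≤ ∑ j, √((M j * σ).trace.re * (M j * τ).trace.re) := by
  obtain ⟨W, hW, hid⟩ := exists_partialIsometry_mul_eq_sqrt (CFC.sqrt σ * CFC.sqrt τ)
  have hA : (CFC.sqrt σ * CFC.sqrt τ)ᴴ * (CFC.sqrt σ * CFC.sqrt τ)
      = CFC.sqrt τ * σ * CFC.sqrt τ := by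
    rw [conjTranspose_mul, isHermitian_sqrt, isHermitian_sqrt]
    conv_rhs => rw [← sqrt_mul_sqrt hσ]
    simp only [mul_assoc]
  rw [hA] at hW
  have hsum : W * (CFC.sqrt σ * CFC.sqrt τ)
      = ∑ j, W * (CFC.sqrt σ * M j * CFC.sqrt τ) := by
    rw [← Finset.mul_sum, ← Finset.sum_mul, ← Finset.mul_sum, hM.sum_eq_one, mul_one]
  rw [bhattacharyya, ← hW, hsum, trace_sum, Complex.re_sum]
  refine Finset.sum_le_sum fun j _ ↦ ?_
  have hMM := sqrt_mul_sqrt (hM.posSemidef j)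
  set s := CFC.sqrt σ
  set t := CFC.sqrt τ
  set m := CFC.sqrt (M j)
  have hs : sᴴ = s := isHermitian_sqrt σ
  have ht : tᴴ = t := isHermitian_sqrt τ
  have hm : mᴴ = m := isHermitian_sqrt (M j)
  have hC := re_trace_conjTranspose_mul_le (m * s * Wᴴ) (m * t)
  have e1 : (m * s * Wᴴ)ᴴ = W * s * m := by
    simp only [conjTranspose_mul, conjTranspose_conjTranspose, hs, hm, mul_assoc]
  have e2 : W * s * m * (m * t) = W * (s * M j * t) := by
    rw [← hMM]; simp only [mul_assoc]
  have e3 : W * s * m * (m * s * Wᴴ) = W * (s * M j * s) * Wᴴ := by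
    rw [← hMM]; simp only [mul_assoc]
  have e4 : ((m * t)ᴴ * (m * t)).trace = (M j * τ).trace := by
    rw [conjTranspose_mul, ht, hm, ← hMM, ← sqrt_mul_sqrt hτ, trace_mul_comm, ← mul_assoc,
      trace_mul_comm, ← mul_assoc, ← mul_assoc, ← mul_assoc]
  have e5 : (s * M j * s).trace = (M j * σ).trace := by
    rw [trace_mul_cycle, sqrt_mul_sqrt hσ, trace_mul_comm]
  have hN : (s * M j * s).PosSemidef := by
    simpa only [hs] using (hM.posSemidef j).mul_mul_conjTranspose_same s
  rw [e1, e2, e3, e4] at hC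
  refine hC.trans (Real.sqrt_le_sqrt ?_)
  rw [← e5]
  refine mul_le_mul_of_nonneg_right (re_trace_conj_le hid hN) ?_
  rw [← e4]
  exact re_trace_nonneg (posSemidef_conjTranspose_mul_self _)

theorem bhattacharyya_nonneg (σ τ : Matrix d d ℂ) : 0 ≤ bhattacharyya σ τ :=
  re_trace_nonneg (nonneg_iff_posSemidef.mp (CFC.sqrt_nonneg _))

/-- Measurement monotonicity, applied to the POVM with the single element `1`. -/
theorem bhattacharyya_le_one {σ τ : Matrix d d ℂ} (hσ : IsDensityMatrix σ)
    (hτ : IsDensityMatrix τ) : bhattacharyya σ τ ≤ 1 := by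
  have hM : IsPOVM (fun _ : Unit ↦ (1 : Matrix d d ℂ)) := ⟨fun _ ↦ PosSemidef.one, by simp⟩
  simpa [hσ.trace_eq_one, hτ.trace_eq_one] using
    bhattacharyya_le_sum_sqrt hM hσ.posSemidef hτ.posSemidef

theorem re_trace_mul_le_fidelity {σ τ : Matrix d d ℂ} (hσ : σ.PosSemidef) (hτ : τ.PosSemidef) :
    (σ * τ).trace.re ≤ fidelity σ τ := by
  have hA : (CFC.sqrt τ * σ * CFC.sqrt τ).PosSemidef := by
    simpa only [isHermitian_sqrt] using hσ.mul_mul_conjTranspose_same (CFC.sqrt τ)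
  have h := re_trace_mul_self_le_sq (nonneg_iff_posSemidef.mp
    (CFC.sqrt_nonneg (CFC.sqrt τ * σ * CFC.sqrt τ)))
  rwa [sqrt_mul_sqrt hA, trace_mul_cycle, sqrt_mul_sqrt hτ, trace_mul_comm] at h

theorem re_trace_mul_le_bhattacharyya {σ τ : Matrix d d ℂ} (hσ : IsDensityMatrix σ)
    (hτ : IsDensityMatrix τ) : (σ * τ).trace.re ≤ bhattacharyya σ τ :=
  (re_trace_mul_le_fidelity hσ.posSemidef hτ.posSemidef).trans
    (pow_le_of_le_one (bhattacharyya_nonneg σ τ) (bhattacharyya_le_one hσ hτ) two_ne_zero)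

/-! ### Diagonal states -/

theorem sqrt_diagonal {r : d → ℝ} (hr : ∀ x, 0 ≤ r x) :
    CFC.sqrt (diagonal fun x ↦ (r x : ℂ)) = diagonal fun x ↦ ((√(r x) : ℝ) : ℂ) := by
  refine CFC.sqrt_unique ?_ (PosSemidef.diagonal fun x ↦ ?_).nonneg
  · rw [diagonal_mul_diagonal]
    congr 1; funext x
    rw [← Complex.ofReal_mul, Real.mul_self_sqrt (hr x)]
  · exact Complex.zero_le_real.mpr (Real.sqrt_nonneg _)

theorem bhattacharyya_diagonal {r s : d → ℝ} (hr : ∀ x, 0 ≤ r x) (hs : ∀ x, 0 ≤ s x) :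
    bhattacharyya (diagonal fun x ↦ (r x : ℂ)) (diagonal fun x ↦ (s x : ℂ))
      = classicalBhattacharyya r s := by
  have h : CFC.sqrt (diagonal fun x ↦ (s x : ℂ)) * (diagonal fun x ↦ (r x : ℂ))
      * CFC.sqrt (diagonal fun x ↦ (s x : ℂ)) = diagonal fun x ↦ ((r x * s x : ℝ) : ℂ) := by
    rw [sqrt_diagonal hs, diagonal_mul_diagonal, diagonal_mul_diagonal]
    congr 1; funext x
    rw [← Complex.ofReal_mul, ← Complex.ofReal_mul, mul_right_comm, Real.mul_self_sqrt (hs x),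
      mul_comm]
  rw [bhattacharyya, h, sqrt_diagonal fun x ↦ mul_nonneg (hr x) (hs x), trace_diagonal,
    Complex.re_sum]
  rfl

theorem ccState_eq_diagonal [Fintype ι] [DecidableEq ι] [Fintype κ] [DecidableEq κ]
    (r : ι × κ → ℝ) : ccState r = diagonal fun x ↦ (r x : ℂ) := by
  simp only [ccState, single_kronecker_single, mul_one, smul_single, smul_eq_mul]
  rw [← Fintype.sum_prod_type' (fun i j ↦ single (i, j) (i, j) (r (i, j) : ℂ))]
  exact sum_single_eq_diagonal _

/-! ### Ensembles and measurements -/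

theorem condProb_eq {M : κ → Matrix d d ℂ} {j : κ} (hM : (M j).PosSemidef)
    (ρ : ι → Matrix d d ℂ) (i : ι) : condProb ρ M i j = (M j * ρ i).trace.re := by
  rw [condProb, trace_mul_cycle, sqrt_mul_sqrt hM]

theorem condProb_nonneg {ρ : ι → Matrix d d ℂ} {i : ι} (hρ : (ρ i).PosSemidef)
    (M : κ → Matrix d d ℂ) (j : κ) : 0 ≤ condProb ρ M i j := by
  refine re_trace_nonneg ?_
  simpa only [isHermitian_sqrt] using hρ.mul_mul_conjTranspose_same (CFC.sqrt (M j))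

section Ensemble

variable [Fintype ι] {p : ι → ℝ} {ρ : ι → Matrix d d ℂ}

theorem outcomeProb_eq_sum {M : κ → Matrix d d ℂ} {j : κ} (hM : (M j).PosSemidef) :
    outcomeProb p ρ M j = ∑ i, p i * condProb ρ M i j := by
  simp [outcomeProb, averageState, Finset.mul_sum, trace_sum, condProb_eq hM]

theorem purity_averageState :
    purity (averageState p ρ) = ∑ i, p i * (ρ i * averageState p ρ).trace.re := by
  rw [purity, sq]
  nth_rw 1 [averageState]
  simp [Finset.sum_mul, trace_sum]

theorem sum_mul_bhattacharyya_le [Fintype κ] {M : κ → Matrix d d ℂ} (hM : IsPOVM M)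
    (hp : p ∈ stdSimplex ℝ ι) (hρ : ∀ i, IsDensityMatrix (ρ i)) :
    ∑ i, p i * bhattacharyya (ρ i) (averageState p ρ)
      ≤ classicalBhattacharyya (jointProb p ρ M) (productProb p ρ M) := by
  rw [classicalBhattacharyya, Fintype.sum_prod_type]
  refine Finset.sum_le_sum fun i _ ↦ ?_
  have h := bhattacharyya_le_sum_sqrt hM (hρ i).posSemidef
    (isDensityMatrix_averageState hp hρ).posSemidef
  refine (mul_le_mul_of_nonneg_left h (hp.1 i)).trans_eq ?_
  rw [Finset.mul_sum]
  refine Finset.sum_congr rfl fun j _ ↦ ?_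
  rw [jointProb, productProb, outcomeProb, condProb_eq (hM.posSemidef j), mul_mul_mul_comm,
    Real.sqrt_mul (mul_self_nonneg _), Real.sqrt_mul_self (hp.1 i)]

end Ensemble

end BhattacharyyaHolevo

theorem mainTheorem4 {d ι κ : Type*} [Fintype d] [DecidableEq d]
    [Fintype ι] [DecidableEq ι] [Fintype κ] [DecidableEq κ]
    (p : ι → ℝ) (hp : p ∈ stdSimplex ℝ ι)
    (ρ : ι → Matrix d d ℂ) (hρ : ∀ i, BhattacharyyaHolevo.IsDensityMatrix (ρ i))
    (M : κ → Matrix d d ℂ) (hM : BhattacharyyaHolevo.IsPOVM M) :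
    -- the distance-based Holevo inequality for the squared Bures distance
    BhattacharyyaHolevo.sqBures
        (BhattacharyyaHolevo.ccState (BhattacharyyaHolevo.jointProb p ρ M))
        (BhattacharyyaHolevo.ccState (BhattacharyyaHolevo.productProb p ρ M))
      ≤ ∑ i, p i * BhattacharyyaHolevo.sqBures (ρ i) (BhattacharyyaHolevo.averageState p ρ) ∧
    -- its form for the Bhattacharyya coefficient
    BhattacharyyaHolevo.classicalBhattacharyya
        (BhattacharyyaHolevo.jointProb p ρ M) (BhattacharyyaHolevo.productProb p ρ M)
      ≥ ∑ i, p i *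
          BhattacharyyaHolevo.bhattacharyya (ρ i) (BhattacharyyaHolevo.averageState p ρ) ∧
    -- the fidelity bound
    (∀ σ τ : Matrix d d ℂ, BhattacharyyaHolevo.IsDensityMatrix σ →
      BhattacharyyaHolevo.IsDensityMatrix τ →
      BhattacharyyaHolevo.fidelity σ τ ≥ (σ * τ).trace.re) ∧
    -- the purity bound
    BhattacharyyaHolevo.classicalBhattacharyya
        (BhattacharyyaHolevo.jointProb p ρ M) (BhattacharyyaHolevo.productProb p ρ M)
      ≥ BhattacharyyaHolevo.purity (BhattacharyyaHolevo.averageState p ρ) := by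
  open BhattacharyyaHolevo in
  have key := sum_mul_bhattacharyya_le hM hp hρ
  refine ⟨?_, key, fun σ τ hσ hτ ↦ re_trace_mul_le_fidelity hσ.posSemidef hτ.posSemidef, ?_⟩
  · have hP (x : ι × κ) : 0 ≤ jointProb p ρ M x :=
      mul_nonneg (hp.1 _) (condProb_nonneg (hρ _).posSemidef M _)
    have hQ (x : ι × κ) : 0 ≤ productProb p ρ M x := by
      refine mul_nonneg (hp.1 _) ?_
      rw [outcomeProb_eq_sum (hM.posSemidef _)]
      exact Finset.sum_nonneg fun i _ ↦
        mul_nonneg (hp.1 i) (condProb_nonneg (hρ i).posSemidef M _)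
    have hB : ∑ i, p i * sqBures (ρ i) (averageState p ρ)
        = 2 * (1 - ∑ i, p i * bhattacharyya (ρ i) (averageState p ρ)) := by
      rw [← hp.2, ← Finset.sum_sub_distrib, Finset.mul_sum]
      exact Finset.sum_congr rfl fun i _ ↦ by rw [sqBures]; ring
    rw [sqBures, ccState_eq_diagonal, ccState_eq_diagonal, bhattacharyya_diagonal hP hQ, hB]
    linarith
  · refine le_trans ?_ key
    rw [purity_averageState]
    exact Finset.sum_le_sum fun i _ ↦ mul_le_mul_of_nonneg_left
      (re_trace_mul_le_bhattacharyya (hρ i) (isDensityMatrix_averageState hp hρ)) (hp.1 i)
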